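/- Let $G=(V,E)$ be a finite graph. For $\mathbf p : V\to\mathbb C^d$ and an edge $uv\in E$ put $m_{uv}(\mathbf p)=\sum_{k=1}^d(\mathbf p(u)_k-\mathbf p(v)_k)^2$, and let $M_{d,G}\subseteq\mathbb C^E$ be the Zariski closure of the image of the map $\mathbf p\mapsto (m_{uv}(\mathbf p))_{uv\in E}$. A permutation $\varphi$ of $E$ is called a permutation automorphism of $W\subseteq\mathbb C^E$ if the corresponding permutation of coordinates $x\mapsto x\circ\varphi$ maps $W$ onto $W$; it is called trivial if it is induced by a graph automorphism of $G$, i.e. there is $\tau\in\operatorname{Aut}(G)$ with $\varphi(uv)=\tau(u)\tau(v)$ for all $uv\in E$. Let $K_{5,5}$ be the complete bipartite graph with parts $\{0,\dots,4\}$ and $\{5,\dots,9\}$, let $d_{ij}$ ($0\le i\le 4$, $5\le j\le 9$) be variables indexed by its 25 edges, and let \[ M=\begin{pmatrix} 0&1&1&1&1&1\\ 1&d_{05}&d_{06}&d_{07}&d_{08}&d_{09}\\ 1&d_{15}&d_{16}&d_{17}&d_{18}&d_{19}\\ 1&d_{25}&d_{26}&d_{27}&d_{28}&d_{29}\\ 1&d_{35}&d_{36}&d_{37}&d_{38}&d_{39}\\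 1&d_{45}&d_{46}&d_{47}&d_{48}&d_{49} \end{pmatrix}. \] Then: 1. The polynomial $\det M\in\mathbb C[d_{ij}]$ is irreducible, and $M_{3,K_{5,5}}$ is the hypersurface $\{x\in\mathbb C^{25} : (\det M)(x)=0\}$. 2. A permutation $\varphi$ of the edge set of $K_{5,5}$ is a permutation automorphism of $M_{3,K_{5,5}}$ if and only if it is trivial. -/

import Mathlib

noncomputable section

namespace SimpleGraph

/-- The complex squared length of a pair of vertices in the configuration `p : V → ℂ^d`
(no complex conjugation). -/
def sqLength {V : Type*} {d : ℕ} (p : V → Fin d → ℂ) : Sym2 V → ℂ :=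
  Sym2.lift ⟨fun u v => ∑ k, (p u k - p v k) ^ 2, fun u v =>
    Finset.sum_congr rfl fun k _ => by ring⟩

/-- The measurement map `m_{d,G} : (ℂ^d)^V → ℂ^E`. -/
def measurementMap {V : Type*} (d : ℕ) (G : SimpleGraph V) (p : V → Fin d → ℂ) :
    G.edgeSet → ℂ :=
  fun e => sqLength p (e : Sym2 V)

/-- The measurement variety `M_{d,G}`: the Zariski closure in `ℂ^E` of the image of the
measurement map, i.e. the common zero locus of all polynomials vanishing on that image. -/
def measurementVariety {V : Type*} (d : ℕ) (G : SimpleGraph V) : Set (G.edgeSet → ℂ) :=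
  MvPolynomial.zeroLocus ℂ (MvPolynomial.vanishingIdeal ℂ (Set.range (measurementMap d G)))

/-- The permutation `φ` of the coordinates induces an automorphism of `W ⊆ ℂ^ι`: the
coordinate-permuting linear map `x ↦ x ∘ φ` maps `W` onto itself. -/
def IsPermutationAutomorphism {ι : Type*} (W : Set (ι → ℂ)) (φ : Equiv.Perm ι) : Prop :=
  (fun x : ι → ℂ => x ∘ φ) '' W = W

/-- An edge permutation is trivial when it is induced by a graph automorphism. -/
def IsTrivialEdgePerm {V : Type*} (G : SimpleGraph V) (φ : Equiv.Perm G.edgeSet) : Prop :=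
  ∃ τ : G ≃g G, φ = τ.mapEdgeSet

/-- The graph `K_{5,5}`. -/
abbrev K55 : SimpleGraph (Fin 5 ⊕ Fin 5) := completeBipartiteGraph (Fin 5) (Fin 5)

/-- The edge of `K_{5,5}` joining vertex `i` of the first part to vertex `j` of the second. -/
def K55edge (i j : Fin 5) : K55.edgeSet :=
  ⟨s(Sum.inl i, Sum.inr j), by simp⟩

/-- The `6 × 6` matrix `[[0, 1ᵀ], [1, (d_{ij})]]` over the polynomial ring in the 25 edge variables
of `K_{5,5}`: the submatrix of the Cayley–Menger matrix of ten points with rows the border and the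
first five points, and columns the border and the last five points. -/
def K55matrix : Matrix (Unit ⊕ Fin 5) (Unit ⊕ Fin 5) (MvPolynomial K55.edgeSet ℂ) :=
  Matrix.fromBlocks 0 (Matrix.of fun _ _ => 1) (Matrix.of fun _ _ => 1)
    (Matrix.of fun i j => MvPolynomial.X (K55edge i j))

end SimpleGraph

end

/-! The determinant is affine in each row and each column of variables. If it factors, each row and
each column is therefore absent from one factor. No row absent from one factor can meet a column
absent from the other, because every variable occurs in the determinant; hence one factor lacks all
variables and is constant.

The determinant vanishes on squared lengths because the bordered matrix factors through dimension 3
+ 2 = 5 < 6. Conversely, a polynomial vanishing on all measurements is pseudo-divided by the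
determinant, which is linear in one chosen variable. The remainder involves only the other 24
lengths. These are algebraically independent, by surjectivity of a derivative at an explicit
placement, so the remainder is zero. Primality then gives divisibility (`K55matrix_det_dvd`).

For the permutations, `CornerClosed` is a property of a pair of coordinates that depends only on the
variety; for distinct edges it holds exactly when they share a vertex. An automorphism thus
preserves adjacency in the 5 × 5 rook's graph, so it permutes rows and columns, possibly exchanging
the two kinds. -/

noncomputable section

/-! ### Bordered determinants -/

namespace Matrix

variable {n R S : Type*} [Fintype n] [DecidableEq n] [CommRing R] [CommRing S]

/-- The determinant of the matrix `[[0, 1ᵀ], [1, D]]`. -/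
def borderedDet (D : Matrix n n R) : R :=
  (fromBlocks (0 : Matrix Unit Unit R) (of fun _ _ => 1) (of fun _ _ => 1) D).det

theorem borderedDet_transpose (D : Matrix n n R) : borderedDet Dᵀ = borderedDet D := by
  unfold borderedDet
  rw [← det_transpose, fromBlocks_transpose]
  rfl

theorem map_borderedDet (f : R →+* S) (D : Matrix n n R) :
    f (borderedDet D) = borderedDet (D.map f) := by
  unfold borderedDet
  rw [RingHom.map_det, RingHom.mapMatrix_apply, fromBlocks_map]
  congr 2
  · ext; simp
  · ext; simp
  · ext; simp

theorem borderedDet_eq_zero_of_row_eq {D : Matrix n n R} {i j : n} (hij : i ≠ j)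
    (h : D i = D j) : borderedDet D = 0 := by
  refine det_zero_of_row_eq (i := Sum.inr i) (j := Sum.inr j) (by simpa using hij) ?_
  funext k
  cases k <;> simp [fromBlocks, h]

omit [Fintype n] in
theorem fromBlocks_updateRow_border (D : Matrix n n R) (i : n) (u : n → R) :
    fromBlocks (0 : Matrix Unit Unit R) (of fun _ _ => 1) (of fun _ _ => 1) (D.updateRow i u) =
      (fromBlocks (0 : Matrix Unit Unit R) (of fun _ _ => 1) (of fun _ _ => 1) D).updateRow
        (Sum.inr i) (Sum.elim 1 u) := by
  ext a b
  rcases a with a | a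
  · rcases b with b | b <;> simp
  · rcases b with b | b <;> by_cases h : a = i <;> simp [updateRow_apply, h]

/-- The bordered determinant is an affine function of each row. -/
theorem borderedDet_updateRow_affine (D : Matrix n n R) (i : n) (s : R) (u v : n → R) :
    borderedDet (D.updateRow i (s • u + (1 - s) • v)) =
      s * borderedDet (D.updateRow i u) + (1 - s) * borderedDet (D.updateRow i v) := by
  have h : (Sum.elim 1 (s • u + (1 - s) • v) : Unit ⊕ n → R) =
      s • (Sum.elim 1 u : Unit ⊕ n → R) + (1 - s) • (Sum.elim 1 v : Unit ⊕ n → R) := by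
    funext k
    cases k <;> simp
  simp only [borderedDet, fromBlocks_updateRow_border]
  rw [h, det_updateRow_add, det_updateRow_smul, det_updateRow_smul]

/-- Scaling a row by the formal variable gives a polynomial of degree at most one. -/
theorem natDegree_borderedDet_updateRow_smul_le (D : Matrix n n R) (i : n) :
    (borderedDet ((D.map Polynomial.C).updateRow i
      ((Polynomial.X : Polynomial R) • fun j => Polynomial.C (D i j)))).natDegree ≤ 1 := by
  -- Scaling by `X` is the affine combination of the row and the zero row with weights `X` and `1 -
  -- X`.
  have h := borderedDet_updateRow_affine (D.map Polynomial.C) i Polynomial.X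
    (fun j => Polynomial.C (D i j)) 0
  rw [smul_zero, add_zero] at h
  have h1 : (D.map Polynomial.C).updateRow i (fun j => Polynomial.C (D i j)) =
      D.map Polynomial.C := by
    ext a b : 2
    by_cases ha : a = i
    · subst ha; simp
    · simp [ha]
  have h2 : (D.map Polynomial.C).updateRow i 0 = (D.updateRow i 0).map Polynomial.C := by
    ext a b : 2
    by_cases ha : a = i
    · subst ha; simp
    · simp [ha]
  rw [h, h1, h2, ← map_borderedDet, ← map_borderedDet]
  compute_degree

/-- The bordered determinant of a partial permutation matrix missing exactly one row. -/
theorem borderedDet_ne_zero_of_partial_perm {K : Type*} [Field K] (σ : Equiv.Perm n) (k : n) :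
    borderedDet (of fun i j => if i ≠ k ∧ j = σ i then (1 : K) else 0) ≠ 0 := by
  intro h0
  -- In a kernel vector, row `k` kills the border entry, the other rows kill all entries but one,
  -- and the border row (entries sum to zero) kills the last.
  obtain ⟨v, hv, hMv⟩ := exists_mulVec_eq_zero_iff.mpr h0
  have hb : ∑ j, v (Sum.inr j) = 0 := by
    have := congrFun hMv (Sum.inl ())
    simpa [mulVec, dotProduct, fromBlocks] using this
  have hk : v (Sum.inl ()) = 0 := by
    have := congrFun hMv (Sum.inr k)
    simpa [mulVec, dotProduct, fromBlocks] using this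
  have hi : ∀ i, i ≠ k → v (Sum.inr (σ i)) = 0 := by
    intro i hi
    have := congrFun hMv (Sum.inr i)
    simpa [mulVec, dotProduct, fromBlocks, hi, hk] using this
  have hσk : v (Sum.inr (σ k)) = 0 := by
    rw [← Equiv.sum_comp σ, Finset.sum_eq_single k] at hb
    · exact hb
    · intro i _ h; exact hi i h
    · simp
  apply hv
  funext a
  rcases a with a | a
  · exact hk
  · obtain ⟨i, rfl⟩ := σ.surjective a
    by_cases h : i = k
    · subst h; exact hσk
    · exact hi i h

/-- The bordered matrix of squared distances between points of a `d`-dimensional space has rank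
at most `d + 2`. -/
theorem borderedDet_sq_dist_eq_zero {K : Type*} [Field K] {d : ℕ}
    (hd : d + 1 < Fintype.card n) (p q : n → Fin d → K) :
    borderedDet (of fun i j => ∑ k, (p i k - q j k) ^ 2) = 0 := by
  by_contra h0
  -- The expansion |p|² · 1 + 1 · |q|² − 2 p·q is a pairing in `d + 2` coordinates; the border is
  -- supplied by basis vectors of the two extra ones.
  let P : Matrix (Unit ⊕ n) (Fin d ⊕ Bool) K := of fun a b =>
    Sum.elim (fun _ => Sum.elim 0 (fun t => cond t 1 0) b)
      (fun i => Sum.elim (fun k => -2 * p i k) (fun t => cond t (∑ k, p i k ^ 2) 1) b) a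
  let Q : Matrix (Fin d ⊕ Bool) (Unit ⊕ n) K := of fun b a =>
    Sum.elim (fun _ => Sum.elim 0 (fun t => cond t 0 1) b)
      (fun j => Sum.elim (fun k => q j k) (fun t => cond t 1 (∑ k, q j k ^ 2)) b) a
  have hPQ : fromBlocks (0 : Matrix Unit Unit K) (of fun _ _ => 1) (of fun _ _ => 1)
      (of fun i j => ∑ k, (p i k - q j k) ^ 2) = P * Q := by
    ext a b
    rcases a with a | a <;> rcases b with b | b
    · simp [P, Q, mul_apply]
    · simp [P, Q, mul_apply]
    · simp [P, Q, mul_apply]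
    · simp only [P, Q, mul_apply, of_apply, Fintype.sum_sum_type, fromBlocks_apply₂₂,
        Sum.elim_inr, Sum.elim_inl, Fintype.sum_bool, cond_true, cond_false, mul_one, one_mul]
      rw [← Finset.sum_add_distrib, ← Finset.sum_add_distrib]
      exact Finset.sum_congr rfl fun k _ => by ring
  have hu : IsUnit (P * Q) := by
    rw [isUnit_iff_isUnit_det, ← hPQ]
    exact isUnit_iff_ne_zero.mpr h0
  have h1 := rank_of_isUnit _ hu
  have h2 := (rank_mul_le_left P Q).trans P.rank_le_card_width
  simp at h1 h2
  omega

end Matrix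
end

/-! ### Polynomials not involving a set of variables -/

noncomputable section

namespace MvPolynomial

variable {σ K : Type*} [Field K]

/-- The values of `f` do not depend on the coordinates in `S`. -/
def Ignores (f : MvPolynomial σ K) (S : Set σ) : Prop :=
  ∀ x y : σ → K, (∀ e ∉ S, x e = y e) → eval x f = eval y f

theorem Ignores.mono {f : MvPolynomial σ K} {S T : Set σ} (h : f.Ignores T) (hST : S ⊆ T) :
    f.Ignores S :=
  fun x y hxy => h x y fun e he => hxy e fun h' => he (hST h')

theorem Ignores.mul {f g : MvPolynomial σ K} {S : Set σ} (hf : f.Ignores S) (hg : g.Ignores S) :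
    (f * g).Ignores S := fun x y hxy => by
  rw [map_mul, map_mul, hf x y hxy, hg x y hxy]

open Classical in
theorem Ignores.union {f : MvPolynomial σ K} {S T : Set σ} (hS : f.Ignores S)
    (hT : f.Ignores T) : f.Ignores (S ∪ T) := fun x y hxy => by
  refine (hS x (fun e => if e ∈ S then y e else x e) fun e he => by simp [he]).trans
    (hT _ _ fun e he => ?_)
  by_cases h : e ∈ S
  · simp [h]
  · simpa [h] using hxy e (by simp [h, he])

theorem Ignores.iUnion {ι : Type*} [Finite ι] {f : MvPolynomial σ K} {S : ι → Set σ}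
    (hS : ∀ i, f.Ignores (S i)) : f.Ignores (⋃ i, S i) := by
  classical
  have := Fintype.ofFinite ι
  have key : ∀ s : Finset ι, f.Ignores (⋃ i ∈ s, S i) := by
    intro s
    induction s using Finset.induction_on with
    | empty =>
      intro x y hxy
      rw [show x = y from _root_.funext fun e => hxy e (by simp)]
    | insert a s _ ih =>
      rw [Finset.set_biUnion_insert]
      exact (hS a).union ih
  simpa using key Finset.univ

theorem Ignores.eq_C [Infinite K] {f : MvPolynomial σ K} (h : f.Ignores Set.univ) :
    f = C (eval 0 f) :=
  funext fun x => by rw [eval_C]; exact h x 0 (by simp)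

open Classical in
/-- Scale the variables in `S` by a new formal variable. -/
def scaleVars (S : Set σ) : MvPolynomial σ K →ₐ[K] Polynomial (MvPolynomial σ K) :=
  aeval fun e => if e ∈ S then Polynomial.X * Polynomial.C (X e) else Polynomial.C (X e)

open Classical in
theorem eval_eval_scaleVars (S : Set σ) (x : σ → K) (t : K) (f : MvPolynomial σ K) :
    eval x ((scaleVars S f).eval (C t)) = eval (fun e => if e ∈ S then t * x e else x e) f := by
  induction f using MvPolynomial.induction_on with
  | C a => simp [scaleVars, ← algebraMap_eq, Polynomial.algebraMap_apply]
  | add p q hp hq => rw [map_add, Polynomial.eval_add, map_add, hp, hq, map_add]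
  | mul_X p e hp =>
    rw [map_mul, Polynomial.eval_mul, map_mul, hp, map_mul]
    congr 1
    by_cases h : e ∈ S <;> simp [scaleVars, h, mul_comm t]

/-- Constancy in the scaling variable equates scale 1, the original value, with scale 0, where the
coordinates in `S` are erased. -/
theorem ignores_of_natDegree_scaleVars {S : Set σ} {f : MvPolynomial σ K}
    (h : (scaleVars S f).natDegree = 0) : f.Ignores S := by
  classical
  obtain ⟨a, ha⟩ := Polynomial.natDegree_eq_zero.mp h
  have key : ∀ x, eval x f = eval (fun e => if e ∈ S then 0 else x e) f := by
    intro x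
    have h1 := eval_eval_scaleVars S x 1 f
    have h0 := eval_eval_scaleVars S x 0 f
    rw [← ha, Polynomial.eval_C] at h1 h0
    simp only [one_mul, ite_self, zero_mul] at h1 h0
    rw [← h1, h0]
  intro x y hxy
  rw [key x, key y]
  congr 2
  funext e
  by_cases he : e ∈ S
  · simp [he]
  · simpa [he] using hxy e he

/-- If a product is of degree at most one in a group of variables, then one of the factors does
not involve these variables. -/
theorem ignores_or_ignores_of_natDegree_scaleVars_le_one {S : Set σ} {f g : MvPolynomial σ K}
    (h : (scaleVars S (f * g)).natDegree ≤ 1) : f.Ignores S ∨ g.Ignores S := by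
  by_cases hf : scaleVars S f = 0
  · exact Or.inl (ignores_of_natDegree_scaleVars (by rw [hf, Polynomial.natDegree_zero]))
  by_cases hg : scaleVars S g = 0
  · exact Or.inr (ignores_of_natDegree_scaleVars (by rw [hg, Polynomial.natDegree_zero]))
  rw [map_mul, Polynomial.natDegree_mul hf hg] at h
  rcases Nat.eq_zero_or_pos (scaleVars S f).natDegree with h0 | h0
  · exact Or.inl (ignores_of_natDegree_scaleVars h0)
  · exact Or.inr (ignores_of_natDegree_scaleVars (by omega))

end MvPolynomial

/-! ### Irreducibility of the determinant -/

namespace SimpleGraph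

open Matrix MvPolynomial

theorem K55edge_inj {i j i' j' : Fin 5} : K55edge i j = K55edge i' j' ↔ i = i' ∧ j = j' := by
  simp [K55edge]

theorem exists_eq_K55edge (e : K55.edgeSet) : ∃ i j, e = K55edge i j := by
  obtain ⟨e, he⟩ := e
  induction e using Sym2.ind with
  | _ a b =>
    rcases a with a | a <;> rcases b with b | b
    · simp at he
    · exact ⟨a, b, rfl⟩
    · exact ⟨b, a, Subtype.ext Sym2.eq_swap⟩
    · simp at he

theorem K55matrix_det :
    K55matrix.det = borderedDet (of fun i j => (X (K55edge i j) : MvPolynomial K55.edgeSet ℂ)) :=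
  rfl

theorem map_K55matrix_det {R : Type*} [CommRing R] (f : MvPolynomial K55.edgeSet ℂ →+* R) :
    f K55matrix.det = borderedDet (of fun i j => f (X (K55edge i j))) := by
  rw [K55matrix_det, map_borderedDet]
  rfl

theorem eval_K55matrix_det (x : K55.edgeSet → ℂ) :
    eval x K55matrix.det = borderedDet (of fun i j => x (K55edge i j)) := by
  rw [map_K55matrix_det]
  simp

open Classical in
/-- The indicator of the edges `K55edge a (σ a)` with `a ∉ s`. -/
def matchingPoint (σ : Equiv.Perm (Fin 5)) (s : Set (Fin 5)) : K55.edgeSet → ℂ :=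
  fun e => if ∃ a, a ∉ s ∧ e = K55edge a (σ a) then 1 else 0

open Classical in
theorem matchingPoint_K55edge (σ : Equiv.Perm (Fin 5)) (s : Set (Fin 5)) (i j : Fin 5) :
    matchingPoint σ s (K55edge i j) = if i ∉ s ∧ j = σ i then 1 else 0 := by
  unfold matchingPoint
  congr 1
  simp only [K55edge_inj, eq_iff_iff]
  constructor
  · rintro ⟨a, ha, rfl, rfl⟩
    exact ⟨ha, rfl⟩
  · rintro ⟨h, rfl⟩
    exact ⟨i, h, rfl, rfl⟩

theorem eval_matchingPoint_ne_zero (σ : Equiv.Perm (Fin 5)) (k : Fin 5) :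
    eval (matchingPoint σ {k}) K55matrix.det ≠ 0 := by
  rw [eval_K55matrix_det]
  have h : (of fun i j => matchingPoint σ {k} (K55edge i j)) =
      of fun i j => if i ≠ k ∧ j = σ i then (1 : ℂ) else 0 := by
    ext i j
    simp [matchingPoint_K55edge]
  rw [h]
  exact borderedDet_ne_zero_of_partial_perm σ k

theorem eval_matchingPoint_eq_zero (σ : Equiv.Perm (Fin 5)) {s : Set (Fin 5)} {k l : Fin 5}
    (hkl : k ≠ l) (hk : k ∈ s) (hl : l ∈ s) : eval (matchingPoint σ s) K55matrix.det = 0 := by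
  rw [eval_K55matrix_det]
  refine borderedDet_eq_zero_of_row_eq hkl ?_
  funext j
  simp [matchingPoint_K55edge, hk, hl]

open Classical in
theorem matchingPoint_of_ne (σ : Equiv.Perm (Fin 5)) (s : Set (Fin 5)) (i : Fin 5)
    {e : K55.edgeSet} (he : e ≠ K55edge i (σ i)) :
    matchingPoint σ (insert i s) e = matchingPoint σ s e := by
  obtain ⟨a, b, rfl⟩ := exists_eq_K55edge e
  rw [matchingPoint_K55edge, matchingPoint_K55edge]
  by_cases ha : a = i
  · subst ha
    have : b ≠ σ a := fun h => he (by rw [h])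
    simp [this]
  · simp [ha]

/-- A perfect matching through this edge, with one other edge dropped, gives a nonzero value;
dropping this edge too leaves two zero rows. -/
theorem not_ignores_K55matrix_det (i j : Fin 5) : ¬ K55matrix.det.Ignores {K55edge i j} := by
  intro h
  obtain ⟨k, hk⟩ := exists_ne i
  let σ := Equiv.swap i j
  have hσ : σ i = j := Equiv.swap_apply_left i j
  apply eval_matchingPoint_ne_zero σ k
  rw [← eval_matchingPoint_eq_zero σ hk (s := {i, k}) (by simp) (by simp)]
  refine h _ _ fun e he => (matchingPoint_of_ne σ {k} i ?_).symm
  rw [hσ]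
  exact he

theorem K55matrix_det_ne_zero : K55matrix.det ≠ 0 := fun h =>
  eval_matchingPoint_ne_zero 1 0 (by rw [h, map_zero])

/-- The edges at the vertex `i` of the first part. -/
def K55row (i : Fin 5) : Set K55.edgeSet := Set.range (K55edge i)

/-- The edges at the vertex `j` of the second part. -/
def K55col (j : Fin 5) : Set K55.edgeSet := Set.range fun i => K55edge i j

theorem natDegree_scaleVars_row (i : Fin 5) :
    (scaleVars (K55row i) K55matrix.det).natDegree ≤ 1 := by
  classical
  have h := natDegree_borderedDet_updateRow_smul_le
    (of fun i j => (X (K55edge i j) : MvPolynomial K55.edgeSet ℂ)) i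
  have h2 := map_K55matrix_det (scaleVars (K55row i) : MvPolynomial K55.edgeSet ℂ →ₐ[ℂ] _).toRingHom
  refine (le_of_eq ?_).trans h
  refine congrArg _ (h2.trans (congrArg _ ?_))
  ext a b : 2
  by_cases ha : a = i
  · subst ha
    simp [scaleVars, K55row]
  · have : K55edge a b ∉ K55row i := by
      rintro ⟨c, hc⟩
      exact ha (K55edge_inj.mp hc).1.symm
    simp [scaleVars, ha, this]

theorem natDegree_scaleVars_col (j : Fin 5) :
    (scaleVars (K55col j) K55matrix.det).natDegree ≤ 1 := by
  classical
  have h := natDegree_borderedDet_updateRow_smul_le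
    (of fun i j => (X (K55edge j i) : MvPolynomial K55.edgeSet ℂ)) j
  have h2 := map_K55matrix_det (scaleVars (K55col j) : MvPolynomial K55.edgeSet ℂ →ₐ[ℂ] _).toRingHom
  rw [← borderedDet_transpose] at h2
  refine (le_of_eq ?_).trans h
  refine congrArg _ (h2.trans (congrArg _ ?_))
  ext b a : 2
  by_cases ha : b = j
  · subst ha
    simp [scaleVars, K55col]
  · have : K55edge a b ∉ K55col j := by
      rintro ⟨c, hc⟩
      exact ha (K55edge_inj.mp hc).2.symm
    simp [scaleVars, ha, this]

theorem not_isUnit_K55matrix_det : ¬ IsUnit K55matrix.det := by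
  intro h
  have := h.map (eval (matchingPoint 1 Set.univ))
  rw [eval_matchingPoint_eq_zero 1 (k := 0) (l := 1) (by decide) (by simp) (by simp)] at this
  exact not_isUnit_zero this

theorem irreducible_K55matrix_det : Irreducible K55matrix.det := by
  refine ⟨not_isUnit_K55matrix_det, fun f h hfh => ?_⟩
  have unit_of : ∀ p : MvPolynomial K55.edgeSet ℂ, p ≠ 0 → (∀ i, p.Ignores (K55row i)) →
      IsUnit p := by
    intro p hp hr
    have hu : p.Ignores Set.univ := (Ignores.iUnion hr).mono fun e _ => by
      obtain ⟨i, j, rfl⟩ := exists_eq_K55edge e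
      exact Set.mem_iUnion.mpr ⟨i, j, rfl⟩
    have hc := hu.eq_C
    rw [hc]
    refine (isUnit_iff_ne_zero.mpr fun h0 => hp ?_).map C
    rw [hc, h0, map_zero]
  have hf0 : f ≠ 0 := fun h0 => K55matrix_det_ne_zero (by rw [hfh, h0, zero_mul])
  have hh0 : h ≠ 0 := fun h0 => K55matrix_det_ne_zero (by rw [hfh, h0, mul_zero])
  have hrow : ∀ i, f.Ignores (K55row i) ∨ h.Ignores (K55row i) := fun i =>
    ignores_or_ignores_of_natDegree_scaleVars_le_one (by
      rw [← hfh]; exact natDegree_scaleVars_row i)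
  have hcol : ∀ j, f.Ignores (K55col j) ∨ h.Ignores (K55col j) := fun j =>
    ignores_or_ignores_of_natDegree_scaleVars_le_one (by
      rw [← hfh]; exact natDegree_scaleVars_col j)
  have hr : ∀ i j, ({K55edge i j} : Set _) ⊆ K55row i := fun i j => by
    rw [Set.singleton_subset_iff]; exact ⟨j, rfl⟩
  have hc : ∀ i j, ({K55edge i j} : Set _) ⊆ K55col j := fun i j => by
    rw [Set.singleton_subset_iff]; exact ⟨i, rfl⟩
  -- Otherwise the variable where the row and column cross would be missing from the product.
  have hx : ∀ i j, f.Ignores (K55row i) → ¬ h.Ignores (K55col j) := fun i j h1 h2 =>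
    not_ignores_K55matrix_det i j (by rw [hfh]; exact (h1.mono (hr i j)).mul (h2.mono (hc i j)))
  have hy : ∀ i j, h.Ignores (K55row i) → ¬ f.Ignores (K55col j) := fun i j h1 h2 =>
    not_ignores_K55matrix_det i j (by rw [hfh]; exact (h2.mono (hc i j)).mul (h1.mono (hr i j)))
  rcases hrow 0 with h0 | h0
  · have hcf : f.Ignores (K55col 0) := (hcol 0).resolve_right (hx 0 0 h0)
    exact Or.inl (unit_of f hf0 fun i => (hrow i).resolve_right fun h1 => hy i 0 h1 hcf)
  · have hch : h.Ignores (K55col 0) := (hcol 0).resolve_left (hy 0 0 h0)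
    exact Or.inr (unit_of h hh0 fun i => (hrow i).resolve_left fun h1 => hx i 0 h1 hch)

end SimpleGraph
end

/-! ### The ideal of relations between edge lengths -/

noncomputable section

namespace MvPolynomial

/-- A polynomial vanishing on a nonempty open set of `ℂ^σ` is zero. -/
theorem eq_zero_of_eventually_eval_eq_zero {σ 𝕜 : Type*} [Fintype σ] [NontriviallyNormedField 𝕜]
    {f : MvPolynomial σ 𝕜} {a : σ → 𝕜} (h : ∀ᶠ y in nhds a, eval y f = 0) : f = 0 := by
  obtain ⟨ε, hε, hb⟩ := Metric.eventually_nhds_iff_ball.mp h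
  refine funext_set (fun i => Metric.ball (a i) ε)
    (fun i => infinite_of_mem_nhds (a i) (Metric.ball_mem_nhds _ hε)) fun x hx => ?_
  rw [map_zero]
  refine hb x ?_
  rw [ball_pi _ hε]
  exact hx

/-- Pseudo-division by a polynomial which is linear in the variable `e`. -/
theorem exists_pseudo_division {σ K : Type*} [Field K] {e : σ} {g A B : MvPolynomial σ K}
    (hg : g = A * X e + B) (hA : A.Ignores {e}) (hB : B.Ignores {e}) (f : MvPolynomial σ K) :
    ∃ (n : ℕ) (q r : MvPolynomial σ K), A ^ n * f = g * q + r ∧ r.Ignores {e} := by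
  have hpow : ∀ n, (A ^ n).Ignores {e} := fun n x y hxy => by
    rw [map_pow, map_pow, hA x y hxy]
  induction f using MvPolynomial.induction_on with
  | C a => exact ⟨0, 0, C a, by ring, fun x y _ => by simp⟩
  | add f f' hf hf' =>
    obtain ⟨n, q, r, h, hr⟩ := hf
    obtain ⟨n', q', r', h', hr'⟩ := hf'
    refine ⟨n + n', A ^ n' * q + A ^ n * q', A ^ n' * r + A ^ n * r', ?_, fun x y hxy => ?_⟩
    · linear_combination A ^ n' * h + A ^ n * h'
    · rw [map_add, map_add, (hpow n').mul hr x y hxy, (hpow n).mul hr' x y hxy]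
  | mul_X f i hf =>
    obtain ⟨n, q, r, h, hr⟩ := hf
    by_cases hi : i = e
    · subst hi
      -- The new remainder term `A * X i * r` is reduced by `A * X i = g - B`.
      refine ⟨n + 1, A * X i * q + r, -(B * r), ?_, fun x y hxy => ?_⟩
      · rw [hg] at h ⊢
        linear_combination A * X i * h
      · rw [map_neg, map_neg, hB.mul hr x y hxy]
    · refine ⟨n, q * X i, r * X i, ?_, hr.mul fun x y hxy => ?_⟩
      · linear_combination X i * h
      · rw [eval_X, eval_X]
        exact hxy i hi

end MvPolynomial

namespace SimpleGraph

open Matrix MvPolynomial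

/-- Positions of the first part of a generic enough placement of `K_{5,5}` in space. -/
def K55placeLeft : Fin 5 → Fin 3 → ℂ :=
  ![![0, 0, 0], ![1, 0, 0], ![0, 1, 0], ![0, 0, 1], ![1, 1, 1]]

/-- Positions of the second part of a generic enough placement of `K_{5,5}` in space. -/
def K55placeRight : Fin 5 → Fin 3 → ℂ :=
  ![![1, 0, -1], ![1, 0, 1], ![-1, 0, 0], ![1, -1, 0], ![0, -1, 0]]

/-- An equilibrium stress of this placement is determined by its value on one edge. -/
theorem K55stress_eq_zero {w : Fin 5 → Fin 5 → ℂ}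
    (hl : ∀ i k, ∑ j, w i j * (K55placeLeft i k - K55placeRight j k) = 0)
    (hr : ∀ j k, ∑ i, w i j * (K55placeLeft i k - K55placeRight j k) = 0)
    (h : w 4 4 = 0) : ∀ i j, w i j = 0 := by
  simp only [Fin.forall_fin_succ, Fin.sum_univ_succ, K55placeLeft, K55placeRight] at hl hr
  simp at hl hr
  intro i j
  fin_cases i <;> fin_cases j <;> simp <;> grind

/-- The space of placements of `K_{5,5}`, with one extra parameter. -/
abbrev K55param : Type := ((Fin 5 → Fin 3 → ℂ) × (Fin 5 → Fin 3 → ℂ)) × ℂ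

/-- The difference of the `k`-th coordinates of the `i`-th point of the first part and the `j`-th
point of the second part. -/
def K55diff (i j : Fin 5) (k : Fin 3) : K55param →L[ℂ] ℂ :=
  (ContinuousLinearMap.proj k).comp ((ContinuousLinearMap.proj (φ := fun _ => Fin 3 → ℂ) i).comp
      ((ContinuousLinearMap.fst ℂ _ _).comp (ContinuousLinearMap.fst ℂ _ _))) -
    (ContinuousLinearMap.proj k).comp ((ContinuousLinearMap.proj (φ := fun _ => Fin 3 → ℂ) j).comp
      ((ContinuousLinearMap.snd ℂ _ _).comp (ContinuousLinearMap.fst ℂ _ _)))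

theorem K55diff_apply (i j : Fin 5) (k : Fin 3) (x : K55param) :
    K55diff i j k x = x.1.1 i k - x.1.2 j k := rfl

/-- Squared lengths of the edges of `K_{5,5}`, with the length of the last edge shifted by the
extra parameter. -/
def K55lengths (x : K55param) (e : Fin 5 × Fin 5) : ℂ :=
  ∑ k, K55diff e.1 e.2 k x ^ 2 + if e = (4, 4) then x.2 else 0

/-- The derivative of `K55lengths`. -/
def K55lengthsDeriv (x : K55param) : K55param →L[ℂ] (Fin 5 × Fin 5 → ℂ) :=
  ContinuousLinearMap.pi fun e => ∑ k, (2 * K55diff e.1 e.2 k x) • K55diff e.1 e.2 k +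
    if e = (4, 4) then ContinuousLinearMap.snd ℂ _ _ else 0

theorem hasStrictFDerivAt_K55lengths (x : K55param) :
    HasStrictFDerivAt K55lengths (K55lengthsDeriv x) x := by
  refine hasStrictFDerivAt_pi.mpr fun e => ?_
  refine HasStrictFDerivAt.fun_add (HasStrictFDerivAt.fun_sum fun k _ => ?_) ?_
  · simpa using ((K55diff e.1 e.2 k).hasStrictFDerivAt (x := x)).pow 2
  · by_cases he : e = (4, 4)
    · simp only [he, if_true]
      exact hasStrictFDerivAt_snd
    · simp only [he, if_false]
      exact hasStrictFDerivAt_const _ _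

theorem K55lengthsDeriv_apply (x v : K55param) (e : Fin 5 × Fin 5) :
    K55lengthsDeriv x v e =
      ∑ k, 2 * (x.1.1 e.1 k - x.1.2 e.2 k) * (v.1.1 e.1 k - v.1.2 e.2 k) +
        if e = (4, 4) then v.2 else 0 := by
  simp only [K55lengthsDeriv, ContinuousLinearMap.pi_apply, _root_.add_apply,
    _root_.sum_apply, _root_.smul_apply, K55diff_apply, smul_eq_mul]
  congr 1
  split_ifs <;> rfl

/-- A functional vanishing on the range has coefficients forming an equilibrium stress. The extra
parameter forces the stress to vanish on edge `(4, 4)`, hence everywhere. -/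
theorem range_K55lengthsDeriv :
    (K55lengthsDeriv ((K55placeLeft, K55placeRight), 0)).range = ⊤ := by
  by_contra hne
  obtain ⟨f, hf0, hf⟩ := Submodule.exists_le_ker_of_lt_top _ (lt_top_iff_ne_top.mpr hne)
  let w : Fin 5 → Fin 5 → ℂ := fun i j => f (Pi.single (i, j) 1)
  have hfw : ∀ y : Fin 5 × Fin 5 → ℂ, f y = ∑ i, ∑ j, y (i, j) * w i j := by
    intro y
    rw [← Fintype.sum_prod_type' (fun i j => y (i, j) * w i j)]
    conv_lhs => rw [pi_eq_sum_univ' y]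
    simp only [map_sum, map_smul, smul_eq_mul, w]
  have hker : ∀ v, f (K55lengthsDeriv ((K55placeLeft, K55placeRight), 0) v) = 0 := fun v =>
    hf ⟨v, rfl⟩
  have hw : ∀ i j, w i j = 0 := by
    refine K55stress_eq_zero (fun i k => ?_) (fun j k => ?_) ?_
    · have h := hker ((Pi.single i (Pi.single k 1), 0), 0)
      rw [hfw, Finset.sum_eq_single i (fun a _ ha => by simp [K55lengthsDeriv_apply, ha])
        (by simp)] at h
      have h2 : (2 : ℂ) * ∑ j, w i j * (K55placeLeft i k - K55placeRight j k) = 0 := by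
        rw [← h, Finset.mul_sum]
        refine Finset.sum_congr rfl fun j _ => ?_
        simp [K55lengthsDeriv_apply, Pi.single_apply]
        ring
      simpa using h2
    · have h := hker ((0, Pi.single j (Pi.single k 1)), 0)
      rw [hfw, Finset.sum_comm, Finset.sum_eq_single j
        (fun a _ ha => by simp [K55lengthsDeriv_apply, ha]) (by simp)] at h
      have h2 : (-2 : ℂ) * ∑ i, w i j * (K55placeLeft i k - K55placeRight j k) = 0 := by
        rw [← h, Finset.mul_sum]
        refine Finset.sum_congr rfl fun i _ => ?_
        simp [K55lengthsDeriv_apply, Pi.single_apply]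
        ring
      simpa using h2
    · have h := hker ((0, 0), 1)
      rw [hfw, ← Fintype.sum_prod_type' (fun i j => _ * w i j),
        Finset.sum_eq_single (4, 4) (fun a _ ha => by simp [K55lengthsDeriv_apply, ha])
        (by simp)] at h
      simpa [K55lengthsDeriv_apply] using h
  exact hf0 (LinearMap.ext fun y => by simp [hfw, hw])

/-- A surjective strict derivative makes the image a neighbourhood of a point. -/
theorem eq_zero_of_eval_K55lengths {f : MvPolynomial (Fin 5 × Fin 5) ℂ}
    (h : ∀ x, eval (K55lengths x) f = 0) : f = 0 := by
  have hmap := (hasStrictFDerivAt_K55lengths ((K55placeLeft, K55placeRight), 0)).map_nhds_eq_of_surj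
    range_K55lengthsDeriv
  refine eq_zero_of_eventually_eval_eq_zero
    (a := K55lengths ((K55placeLeft, K55placeRight), 0)) ?_
  rw [← hmap, Filter.eventually_map]
  exact Filter.Eventually.of_forall h

theorem measurementMap_K55edge {d : ℕ} (p : Fin 5 ⊕ Fin 5 → Fin d → ℂ) (i j : Fin 5) :
    measurementMap d K55 p (K55edge i j) = ∑ k, (p (Sum.inl i) k - p (Sum.inr j) k) ^ 2 := rfl

theorem eval_measurementMap_K55matrix_det (p : Fin 5 ⊕ Fin 5 → Fin 3 → ℂ) :
    eval (measurementMap 3 K55 p) K55matrix.det = 0 := by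
  rw [eval_K55matrix_det]
  exact borderedDet_sq_dist_eq_zero (by simp) (fun i => p (Sum.inl i)) (fun j => p (Sum.inr j))

/-- The edges of `K_{5,5}` as pairs. -/
def K55edgeEquiv : Fin 5 × Fin 5 ≃ K55.edgeSet :=
  Equiv.ofBijective (fun e => K55edge e.1 e.2)
    ⟨fun _ _ h => Prod.ext_iff.mpr (K55edge_inj.mp h), fun e => by
      obtain ⟨i, j, rfl⟩ := exists_eq_K55edge e
      exact ⟨(i, j), rfl⟩⟩

theorem K55edgeEquiv_apply (e : Fin 5 × Fin 5) : K55edgeEquiv e = K55edge e.1 e.2 := rfl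

/-- All but one of the edge lengths are algebraically independent. -/
theorem eq_zero_of_ignores {r : MvPolynomial K55.edgeSet ℂ} (hr : r.Ignores {K55edge 4 4})
    (h : ∀ p, eval (measurementMap 3 K55 p) r = 0) : r = 0 := by
  apply rename_injective _ K55edgeEquiv.symm.injective
  rw [map_zero]
  refine eq_zero_of_eval_K55lengths fun x => ?_
  rw [eval_rename, ← h (Sum.elim x.1.1 x.1.2)]
  refine hr _ _ fun e he => ?_
  rw [Function.comp_apply]
  obtain ⟨⟨i, j⟩, rfl⟩ := K55edgeEquiv.surjective e
  have : (i, j) ≠ (4, 4) := fun h => he (by rw [h]; rfl)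
  rw [Equiv.symm_apply_apply]
  simp [K55lengths, this, K55edgeEquiv_apply, measurementMap_K55edge, K55diff_apply]

/-- `K55matrix.det` is an affine function of each variable. -/
theorem eval_K55matrix_det_affine (x : K55.edgeSet → ℂ) (e : K55.edgeSet) (s : ℂ) :
    eval (Function.update x e s) K55matrix.det =
      s * eval (Function.update x e 1) K55matrix.det +
        (1 - s) * eval (Function.update x e 0) K55matrix.det := by
  obtain ⟨i, j, rfl⟩ := exists_eq_K55edge e
  have key : ∀ t, (of fun a b => Function.update x (K55edge i j) t (K55edge a b)) =
      (of fun a b => x (K55edge a b)).updateRow i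
        (Function.update (fun b => x (K55edge i b)) j t) := by
    intro t
    ext a b
    by_cases ha : a = i
    · subst ha
      by_cases hb : b = j
      · subst hb; simp
      · simp [Function.update_apply, K55edge_inj, hb]
    · simp [Function.update_apply, K55edge_inj, ha]
  rw [eval_K55matrix_det, eval_K55matrix_det, eval_K55matrix_det, key, key, key,
    ← borderedDet_updateRow_affine]
  congr 2
  funext b
  by_cases hb : b = j
  · subst hb; simp
  · simp [hb]
    ring

/-- Substitution of a constant for the variable `e`. -/
def _root_.MvPolynomial.substConst {σ K : Type*} [Field K] [DecidableEq σ] (e : σ) (c : K) :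
    MvPolynomial σ K →ₐ[K] MvPolynomial σ K :=
  aeval (Function.update X e (C c))

theorem _root_.MvPolynomial.eval_substConst {σ K : Type*} [Field K] [DecidableEq σ] (e : σ) (c : K) (x : σ → K)
    (f : MvPolynomial σ K) :
    eval x (substConst e c f) = eval (Function.update x e c) f := by
  induction f using MvPolynomial.induction_on with
  | C a => simp [substConst, algebraMap_eq]
  | add p q hp hq => simp [hp, hq]
  | mul_X p i hp =>
    rw [map_mul, map_mul, map_mul, hp]
    by_cases h : i = e
    · subst h; simp [substConst]
    · simp [substConst, h]

theorem _root_.MvPolynomial.ignores_substConst {σ K : Type*} [Field K] [DecidableEq σ] (e : σ) (c : K)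
    (f : MvPolynomial σ K) : (substConst e c f).Ignores {e} := fun x y hxy => by
  rw [eval_substConst, eval_substConst]
  congr 2
  funext i
  by_cases h : i = e
  · subst h; simp
  · simpa [h] using hxy i h

/-- Every polynomial relation between the edge lengths of `K_{5,5}` in space is a multiple of
`K55matrix.det`. -/
theorem K55matrix_det_dvd {f : MvPolynomial K55.edgeSet ℂ}
    (h : ∀ p, eval (measurementMap 3 K55 p) f = 0) : K55matrix.det ∣ f := by
  classical
  let e := K55edge 4 4
  let B := substConst e 0 K55matrix.det
  let A := substConst e 1 K55matrix.det - B
  have hB : B.Ignores {e} := ignores_substConst _ _ _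
  have hA : A.Ignores {e} := fun x y hxy => by
    rw [map_sub, map_sub, hB x y hxy, ignores_substConst _ _ _ x y hxy]
  have hg : K55matrix.det = A * X e + B := by
    refine MvPolynomial.funext fun x => ?_
    have := eval_K55matrix_det_affine x e (x e)
    rw [Function.update_eq_self] at this
    simp only [A, B, map_add, map_mul, map_sub, eval_X, eval_substConst]
    rw [this]
    ring
  obtain ⟨n, q, r, hq, hr⟩ := exists_pseudo_division hg hA hB f
  have hr0 : r = 0 := eq_zero_of_ignores hr fun p => by
    have := congrArg (eval (measurementMap 3 K55 p)) hq
    rw [map_mul, map_add, map_mul, h, eval_measurementMap_K55matrix_det] at this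
    simpa using this.symm
  rw [hr0, add_zero] at hq
  have hprime : Prime K55matrix.det := irreducible_K55matrix_det.prime
  -- The determinant cannot divide the leading coefficient `A`: a matching with two edges dropped is
  -- a zero of the determinant, but `A` is nonzero there, since restoring edge `(4, 4)` makes the
  -- determinant nonzero.
  refine (hprime.dvd_or_dvd ⟨q, hq⟩).resolve_left fun hdvd => ?_
  obtain ⟨c, hc⟩ := hprime.dvd_of_dvd_pow hdvd
  have h1 : eval (matchingPoint 1 {0, 4}) K55matrix.det = 0 :=
    eval_matchingPoint_eq_zero 1 (k := 0) (l := 4) (by decide) (by simp) (by simp)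
  have h2 := congrArg (eval (matchingPoint 1 {0, 4})) hc
  have h3 : Function.update (matchingPoint 1 {0, 4}) e 0 = matchingPoint 1 {0, 4} := by
    rw [Function.update_eq_self_iff]
    exact (by simp [e, matchingPoint_K55edge])
  have h4 : Function.update (matchingPoint 1 {0, 4}) e 1 = matchingPoint 1 {0} := by
    rw [Function.update_eq_iff]
    refine ⟨by simp [e, matchingPoint_K55edge], fun e' he' => ?_⟩
    rw [Set.pair_comm]
    exact matchingPoint_of_ne 1 {0} 4 he'
  rw [map_mul, h1, zero_mul] at h2
  simp only [A, B, map_sub, eval_substConst] at h2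
  rw [h3, h1, h4, sub_zero] at h2
  exact eval_matchingPoint_ne_zero 1 0 h2

theorem mem_vanishingIdeal_range_measurementMap {f : MvPolynomial K55.edgeSet ℂ} :
    f ∈ vanishingIdeal ℂ (Set.range (measurementMap 3 K55)) ↔ K55matrix.det ∣ f := by
  rw [mem_vanishingIdeal_iff, Set.forall_mem_range]
  simp only [aeval_eq_eval]
  constructor
  · exact fun h => K55matrix_det_dvd h
  · rintro ⟨q, hq⟩ p
    rw [hq, map_mul, eval_measurementMap_K55matrix_det, zero_mul]

theorem measurementVariety_K55 :
    measurementVariety 3 K55 = {x | eval x K55matrix.det = 0} := by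
  ext x
  rw [measurementVariety, mem_zeroLocus_iff]
  simp only [aeval_eq_eval]
  constructor
  · exact fun h => h _ (mem_vanishingIdeal_range_measurementMap.mpr dvd_rfl)
  · intro h f hf
    obtain ⟨q, hq⟩ := mem_vanishingIdeal_range_measurementMap.mp hf
    rw [hq, map_mul, Set.mem_ofPred_eq.mp h, zero_mul]

end SimpleGraph
end

/-! ### Automorphisms of the rook's graph -/

noncomputable section

/-- Two cells of a square grid lie on a common row or column. -/
def ShareLine {α : Type*} (a b : α × α) : Prop := a.1 = b.1 ∨ a.2 = b.2

/-- A permutation of the grid preserving lines and mapping some row into a row is a product. -/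
theorem exists_prod_perm_of_shareLine_of_row {α : Type*} [Finite α] [Nontrivial α]
    (ψ : Equiv.Perm (α × α)) (h : ∀ a b, ShareLine (ψ a) (ψ b) ↔ ShareLine a b)
    (hline : ∀ i, (∀ j j', (ψ (i, j)).1 = (ψ (i, j')).1) ∨ ∀ j j', (ψ (i, j)).2 = (ψ (i, j')).2)
    (i₀ : α) (h₀ : ∀ j j', (ψ (i₀, j)).1 = (ψ (i₀, j')).1) :
    ∃ σ τ : Equiv.Perm α, ∀ i j, ψ (i, j) = (σ i, τ j) := by
  have hψ : ∀ i j j', ψ (i, j) = ψ (i, j') → j = j' := fun i j j' h' =>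
    (Prod.ext_iff.mp (ψ.injective h')).2
  have hrow : ∀ i j j', (ψ (i, j)).1 = (ψ (i, j')).1 := by
    intro i
    by_cases hi : i = i₀
    · rwa [hi]
    -- If row `i` went into a column, that column would meet the image of row `i₀`, a full row, in a
    -- cell collinear with the whole image of row `i`.
    refine (hline i).resolve_right fun hcol => ?_
    have hinj : Function.Injective fun j => (ψ (i₀, j)).2 := fun j j' hj =>
      hψ i₀ j j' (Prod.ext (h₀ j j') hj)
    obtain ⟨j, hj⟩ := Finite.injective_iff_surjective.mp hinj (ψ (i, i₀)).2
    obtain ⟨j', hj'⟩ := exists_ne j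
    have : ShareLine (ψ (i₀, j)) (ψ (i, j')) := Or.inr (hj.trans (hcol _ _))
    rcases (h _ _).mp this with h1 | h1
    · exact hi h1.symm
    · exact hj' h1.symm
  have hσ : Function.Injective fun i => (ψ (i, i₀)).1 := by
    intro i i' hii
    by_contra hne
    obtain ⟨j, hj⟩ := exists_ne i₀
    have : ShareLine (ψ (i, i₀)) (ψ (i', j)) := Or.inl (hii.trans (hrow i' _ _))
    rcases (h _ _).mp this with h1 | h1
    · exact hne h1
    · exact hj h1.symm
  have hcol : ∀ i j, (ψ (i, j)).2 = (ψ (i₀, j)).2 := by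
    intro i j
    by_cases hi : i = i₀
    · rw [hi]
    · have : ShareLine (ψ (i, j)) (ψ (i₀, j)) := (h _ _).mpr (Or.inr rfl)
      refine this.resolve_left fun h1 => hi (hσ ?_)
      exact ((hrow i _ _).trans h1).trans (hrow i₀ _ _)
  have hτ : Function.Injective fun j => (ψ (i₀, j)).2 := fun j j' hj =>
    hψ i₀ j j' (Prod.ext (h₀ j j') hj)
  exact ⟨Equiv.ofBijective _ (Finite.injective_iff_bijective.mp hσ),
    Equiv.ofBijective _ (Finite.injective_iff_bijective.mp hτ),
    fun i j => Prod.ext (hrow i _ _) (hcol i j)⟩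

/-- Automorphisms of the rook's graph of a square board. -/
theorem exists_prod_perm_of_shareLine {α : Type*} [Finite α] [Nontrivial α]
    (ψ : Equiv.Perm (α × α)) (h : ∀ a b, ShareLine (ψ a) (ψ b) ↔ ShareLine a b) :
    ∃ σ τ : Equiv.Perm α, (∀ i j, ψ (i, j) = (σ i, τ j)) ∨ ∀ i j, ψ (i, j) = (τ j, σ i) := by
  have hline : ∀ i, (∀ j j', (ψ (i, j)).1 = (ψ (i, j')).1) ∨
      ∀ j j', (ψ (i, j)).2 = (ψ (i, j')).2 := by
    intro i
    have hs : ∀ j j', ShareLine (ψ (i, j)) (ψ (i, j')) := fun j j' => (h _ _).mpr (Or.inl rfl)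
    by_contra! hne
    obtain ⟨⟨j₀, j₁, hj⟩, k₀, k₁, hk⟩ := hne
    have hc := (hs j₀ j₁).resolve_left hj
    -- A cell collinear with two cells of one column lying in different rows is in that column.
    have key : ∀ k, (ψ (i, k)).2 = (ψ (i, j₀)).2 := fun k => by
      by_contra hne
      have h0 := (hs k j₀).resolve_right hne
      have h1 := (hs k j₁).resolve_right (by rwa [← hc])
      exact hj (h0.symm.trans h1)
    exact hk ((key k₀).trans (key k₁).symm)
  obtain ⟨i₀⟩ : Nonempty α := inferInstance
  rcases hline i₀ with h₀ | h₀
  · obtain ⟨σ, τ, hστ⟩ := exists_prod_perm_of_shareLine_of_row ψ h hline i₀ h₀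
    exact ⟨σ, τ, Or.inl hστ⟩
  · obtain ⟨σ, τ, hστ⟩ := exists_prod_perm_of_shareLine_of_row (ψ.trans (Equiv.prodComm α α))
      (fun a b => or_comm.trans (h a b)) (fun i => (hline i).symm) i₀ h₀
    exact ⟨σ, τ, Or.inr fun i j => Prod.swap_injective (hστ i j)⟩

/-! ### Permutation automorphisms of the variety -/

namespace SimpleGraph

open Matrix MvPolynomial

section Trivial

variable {V : Type*} {d : ℕ} {G : SimpleGraph V}

theorem measurementMap_comp_mapEdgeSet (τ : G ≃g G) (p : V → Fin d → ℂ) :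
    measurementMap d G p ∘ τ.mapEdgeSet = measurementMap d G (p ∘ τ) := by
  funext ⟨e, he⟩
  induction e using Sym2.ind with
  | _ u v => rfl

theorem comp_mapEdgeSet_mem_measurementVariety (τ : G ≃g G) {x : G.edgeSet → ℂ}
    (hx : x ∈ measurementVariety d G) : x ∘ τ.mapEdgeSet ∈ measurementVariety d G := by
  intro f hf
  rw [← aeval_rename]
  refine hx _ ?_
  rintro _ ⟨p, rfl⟩
  rw [aeval_rename, measurementMap_comp_mapEdgeSet]
  exact hf _ ⟨_, rfl⟩

theorem IsTrivialEdgePerm.isPermutationAutomorphism {φ : Equiv.Perm G.edgeSet}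
    (h : IsTrivialEdgePerm G φ) : IsPermutationAutomorphism (measurementVariety d G) φ := by
  obtain ⟨τ, rfl⟩ := h
  refine Set.Subset.antisymm ?_ fun x hx => ?_
  · rintro _ ⟨x, hx, rfl⟩
    exact comp_mapEdgeSet_mem_measurementVariety τ hx
  · refine ⟨_, comp_mapEdgeSet_mem_measurementVariety τ.symm hx, ?_⟩
    funext e
    exact congrArg x (τ.mapEdgeSet.symm_apply_apply e)

end Trivial

theorem IsPermutationAutomorphism.comp_mem_iff {ι : Type*} {W : Set (ι → ℂ)}
    {φ : Equiv.Perm ι} (h : IsPermutationAutomorphism W φ) (x : ι → ℂ) : x ∘ φ ∈ W ↔ x ∈ W := by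
  constructor
  · intro hx
    rw [← h] at hx
    obtain ⟨y, hy, hyx⟩ := hx
    rwa [← φ.surjective.injective_comp_right hyx]
  · intro hx
    rw [← h]
    exact ⟨x, hx, rfl⟩

/-- `W` contains every corner of a square in the coordinates `e`, `e'` whose other three corners it
contains. -/
def CornerClosed {ι : Type*} [DecidableEq ι] (W : Set (ι → ℂ)) (e e' : ι) : Prop :=
  ∀ x : ι → ℂ, Function.update (Function.update x e 0) e' 0 ∈ W →
    Function.update (Function.update x e 1) e' 0 ∈ W →
    Function.update (Function.update x e 0) e' 1 ∈ W →
    Function.update (Function.update x e 1) e' 1 ∈ W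

theorem IsPermutationAutomorphism.cornerClosed_iff {ι : Type*} [DecidableEq ι]
    {W : Set (ι → ℂ)} {φ : Equiv.Perm ι} (h : IsPermutationAutomorphism W φ) (e e' : ι) :
    CornerClosed W (φ e) (φ e') ↔ CornerClosed W e e' := by
  have key : ∀ (x : ι → ℂ) s t, Function.update (Function.update x (φ e) s) (φ e') t ∈ W ↔
      Function.update (Function.update (x ∘ φ) e s) e' t ∈ W := by
    intro x s t
    rw [← h.comp_mem_iff, Function.update_comp_equiv, Function.update_comp_equiv,
      Equiv.symm_apply_apply, Equiv.symm_apply_apply]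
  unfold CornerClosed
  simp only [key]
  exact ((Equiv.arrowCongr φ.symm (Equiv.refl ℂ)).forall_congr fun {x} => Iff.rfl)

/-- The bordered determinant satisfies the parallelogram rule in each row. -/
theorem _root_.Matrix.borderedDet_updateRow_add {n : Type*} [Fintype n] [DecidableEq n]
    (D : Matrix n n ℂ) (i : n) {u v u' v' : n → ℂ} (h : u + v = u' + v') :
    borderedDet (D.updateRow i u) + borderedDet (D.updateRow i v) =
      borderedDet (D.updateRow i u') + borderedDet (D.updateRow i v') := by
  -- By affinity both sides are twice the value at the common midpoint.
  have key : ∀ a b : n → ℂ, borderedDet (D.updateRow i a) + borderedDet (D.updateRow i b) =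
      2 * borderedDet (D.updateRow i ((1 / 2 : ℂ) • (a + b))) := by
    intro a b
    have := borderedDet_updateRow_affine D i (1 / 2) a b
    rw [show (1 - 1 / 2 : ℂ) = 1 / 2 by norm_num, ← smul_add] at this
    rw [this]
    ring
  rw [key, key, h]

theorem _root_.Matrix.updateRow_update_update {n : Type*} [DecidableEq n] (x : n × n → ℂ) (i j j' : n)
    (s t : ℂ) :
    (of fun a b => Function.update (Function.update x (i, j) s) (i, j') t (a, b)) =
      (of fun a b => x (a, b)).updateRow i
        (Function.update (Function.update (fun b => x (i, b)) j s) j' t) := by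
  ext a b
  by_cases ha : a = i
  · subst ha
    simp [Function.update_apply]
  · simp [Function.update_apply, ha]

theorem _root_.Matrix.parallelogram_row {n : Type*} [Fintype n] [DecidableEq n] (x : n × n → ℂ) (i : n)
    {j j' : n} (hj : j ≠ j') (F : ℂ → ℂ → ℂ)
    (hF : ∀ s t, F s t = borderedDet (of fun a b =>
      Function.update (Function.update x (i, j) s) (i, j') t (a, b))) :
    F 1 1 + F 0 0 = F 1 0 + F 0 1 := by
  simp only [hF, updateRow_update_update]
  refine borderedDet_updateRow_add _ _ ?_
  funext b
  by_cases h : b = j'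
  · subst h
    simp
  · by_cases h' : b = j
    · subst h'
      simp [h]
    · simp [h, h']

instance K55edgeDecidableEq : DecidableEq K55.edgeSet := Classical.decEq _

theorem update_update_K55edge (x : K55.edgeSet → ℂ) (e e' : Fin 5 × Fin 5) (s t : ℂ) (a b : Fin 5) :
    Function.update (Function.update x (K55edgeEquiv e) s) (K55edgeEquiv e') t (K55edge a b) =
      Function.update (Function.update (x ∘ K55edgeEquiv) e s) e' t (a, b) := by
  rw [← K55edgeEquiv_apply (a, b)]
  simp [Function.update_apply]

theorem eval_update_update (x : K55.edgeSet → ℂ) (e e' : Fin 5 × Fin 5) (s t : ℂ) :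
    eval (Function.update (Function.update x (K55edgeEquiv e) s) (K55edgeEquiv e') t)
      K55matrix.det = borderedDet (of fun a b =>
        Function.update (Function.update (x ∘ K55edgeEquiv) e s) e' t (a, b)) := by
  rw [eval_K55matrix_det]
  simp only [update_update_K55edge]

theorem cornerClosed_of_shareLine {e e' : Fin 5 × Fin 5} (hne : e ≠ e') (h : ShareLine e e') :
    CornerClosed {x | eval x K55matrix.det = 0} (K55edgeEquiv e) (K55edgeEquiv e') := by
  intro x h00 h10 h01
  simp only [Set.mem_ofPred_eq, eval_update_update] at h00 h10 h01 ⊢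
  obtain ⟨i, j⟩ := e
  obtain ⟨i', j'⟩ := e'
  rcases h with h | h
  · obtain rfl : i = i' := h
    have hj : j ≠ j' := fun h' => hne (by rw [h'])
    have := parallelogram_row (x ∘ K55edgeEquiv) i hj _ fun _ _ => rfl
    simpa [h00, h10, h01] using this
  · obtain rfl : j = j' := h
    have hi : i ≠ i' := fun h' => hne (by rw [h'])
    have := parallelogram_row (x ∘ K55edgeEquiv ∘ Prod.swap) j hi
      (fun s t => borderedDet (of fun a b =>
        Function.update (Function.update (x ∘ K55edgeEquiv) (i, j) s) (i', j) t (a, b)))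
      fun s t => by
        rw [← borderedDet_transpose]
        congr 1
        ext a b
        simp [Function.update_apply, and_comm]
    simpa [h00, h10, h01] using this

/-- Take a perfect matching through both edges with a third edge dropped: the determinant is
nonzero, but dropping either or both of the two edges makes it zero. -/
theorem not_cornerClosed_of_not_shareLine {e e' : Fin 5 × Fin 5} (h : ¬ ShareLine e e') :
    ¬ CornerClosed {x | eval x K55matrix.det = 0} (K55edgeEquiv e) (K55edgeEquiv e') := by
  obtain ⟨i, j⟩ := e
  obtain ⟨i', j'⟩ := e'
  obtain ⟨hi, hj⟩ : i ≠ i' ∧ j ≠ j' := not_or.mp h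
  obtain ⟨k, hk⟩ : ∃ k, k ∉ ({i, i'} : Finset (Fin 5)) := by
    by_contra! hall
    have := Finset.card_le_card (fun k _ => hall k : (Finset.univ : Finset (Fin 5)) ⊆ _)
    have h2 := Finset.card_le_two (a := i) (b := i')
    simp at this
    omega
  simp only [Finset.mem_insert, Finset.mem_singleton, not_or] at hk
  obtain ⟨σ, hσ, hσ'⟩ : ∃ σ : Equiv.Perm (Fin 5), σ i = j ∧ σ i' = j' := by
    let ρ := Equiv.swap i j
    refine ⟨ρ.trans (Equiv.swap (ρ i') j'), ?_, by simp⟩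
    have h1 : ρ i = j := Equiv.swap_apply_left i j
    have h2 : j ≠ ρ i' := fun h' => hi (ρ.injective (h1.trans h'))
    rw [Equiv.trans_apply, h1, Equiv.swap_apply_of_ne_of_ne h2 hj]
  have hadd : ∀ (s : Set (Fin 5)) (a : Fin 5), a ∉ s →
      Function.update (matchingPoint σ (insert a s)) (K55edge a (σ a)) 1 = matchingPoint σ s := by
    intro s a ha
    rw [Function.update_eq_iff]
    exact ⟨by simp [matchingPoint_K55edge, ha], fun e he => matchingPoint_of_ne σ s a he⟩
  have hrem : ∀ (s : Set (Fin 5)) (a : Fin 5), a ∈ s →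
      Function.update (matchingPoint σ s) (K55edge a (σ a)) 0 = matchingPoint σ s := by
    intro s a ha
    rw [Function.update_eq_self_iff]
    simp [matchingPoint_K55edge, ha]
  intro hcc
  have := hcc (matchingPoint σ (insert i (insert i' {k})))
  simp only [K55edgeEquiv_apply, ← hσ, ← hσ', Set.mem_ofPred_eq] at this
  rw [hrem _ i (by simp), hrem _ i' (by simp), hadd _ i (by simp [hi, Ne.symm hk.1]),
    hrem _ i' (by simp), hadd _ i' (by simp [Ne.symm hk.2]), Set.insert_comm,
    hadd _ i' (by simp [Ne.symm hi, Ne.symm hk.2])] at this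
  refine eval_matchingPoint_ne_zero σ k (this ?_ ?_ ?_)
  · exact eval_matchingPoint_eq_zero σ hi (by simp) (by simp)
  · exact eval_matchingPoint_eq_zero σ (k := i') (l := k) (Ne.symm hk.2) (by simp) (by simp)
  · exact eval_matchingPoint_eq_zero σ (k := i) (l := k) (Ne.symm hk.1) (by simp) (by simp)

theorem isTrivialEdgePerm_of_isPermutationAutomorphism {φ : Equiv.Perm K55.edgeSet}
    (h : IsPermutationAutomorphism {x | eval x K55matrix.det = 0} φ) :
    IsTrivialEdgePerm K55 φ := by
  let ψ : Equiv.Perm (Fin 5 × Fin 5) := (K55edgeEquiv.trans φ).trans K55edgeEquiv.symm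
  have hψ : ∀ a, K55edgeEquiv (ψ a) = φ (K55edgeEquiv a) := fun a => by simp [ψ]
  have hcc : ∀ a b, a ≠ b → (CornerClosed {x | eval x K55matrix.det = 0} (K55edgeEquiv a)
      (K55edgeEquiv b) ↔ ShareLine a b) := fun a b hab =>
    ⟨fun hc => by_contra fun hn => not_cornerClosed_of_not_shareLine hn hc,
      cornerClosed_of_shareLine hab⟩
  have hsl : ∀ a b, ShareLine (ψ a) (ψ b) ↔ ShareLine a b := by
    intro a b
    by_cases hab : a = b
    · subst hab
      exact iff_of_true (Or.inl rfl) (Or.inl rfl)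
    · rw [← hcc _ _ hab, ← hcc _ _ (ψ.injective.ne hab), hψ, hψ, h.cornerClosed_iff]
  have hφ : ∀ i j, φ (K55edge i j) = K55edge (ψ (i, j)).1 (ψ (i, j)).2 := fun i j =>
    (hψ (i, j)).symm
  obtain ⟨σ, τ, hστ | hστ⟩ := exists_prod_perm_of_shareLine ψ hsl
  · refine ⟨⟨Equiv.sumCongr σ τ, ?_⟩, Equiv.ext fun e => ?_⟩
    · intro a b
      rcases a with a | a <;> rcases b with b | b <;> simp
    · obtain ⟨i, j, rfl⟩ := exists_eq_K55edge e
      rw [hφ, hστ]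
      rfl
  -- Exchanging rows with columns corresponds to exchanging the two parts of the graph.
  · refine ⟨⟨(Equiv.sumCongr σ τ).trans (Equiv.sumComm _ _), ?_⟩, Equiv.ext fun e => ?_⟩
    · intro a b
      rcases a with a | a <;> rcases b with b | b <;> simp
    · obtain ⟨i, j, rfl⟩ := exists_eq_K55edge e
      rw [hφ, hστ]
      exact Subtype.ext Sym2.eq_swap

end SimpleGraph
end

theorem proposition1 :
    Irreducible SimpleGraph.K55matrix.det ∧
    SimpleGraph.measurementVariety 3 SimpleGraph.K55 =
      {x | MvPolynomial.eval x SimpleGraph.K55matrix.det = 0} ∧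
    ∀ φ : Equiv.Perm SimpleGraph.K55.edgeSet,
      SimpleGraph.IsPermutationAutomorphism
          (SimpleGraph.measurementVariety 3 SimpleGraph.K55) φ ↔
        SimpleGraph.IsTrivialEdgePerm SimpleGraph.K55 φ := by
  refine ⟨SimpleGraph.irreducible_K55matrix_det, SimpleGraph.measurementVariety_K55, fun φ =>
    ⟨fun h => ?_, fun h => h.isPermutationAutomorphism⟩⟩
  rw [SimpleGraph.measurementVariety_K55] at h
  exact SimpleGraph.isTrivialEdgePerm_of_isPermutationAutomorphism h
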